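/- All rings are associative and unital (not necessarily commutative), all modules are unitary, and $n,d\ge 0$ are integers. A left $R$-module $U$ is $n$-presented if there is an exact sequence $F_n\to\cdots\to F_1\to F_0\to U\to 0$ of left $R$-modules with every $F_i$ finitely generated and free. A right $R$-module $M$ is $(n,d)$-flat if $\operatorname{Tor}^R_{d+1}(M,U)=0$ for every $n$-presented left $R$-module $U$. A right $R$-module $G$ is Gorenstein $(n,d)$-flat if there is an exact sequence $\mathbf F=\cdots\to F_1\to F_0\to F^0\to F^1\to\cdots$ of $(n,d)$-flat right $R$-modules with $G\cong\ker(F^0\to F^1)$ such that the complex $\operatorname{Tor}^R_d(\mathbf F,U)$ is exact for every $n$-presented left $R$-module $U$ of finite flat dimension. **Theorem 4.3.** Let $f:R\to S$ be a surjective ring homomorphism such that $S$, regarded as an $R$-module through $f$, is projective both as a left and as a right $R$-module, and let $G$ be a right $S$-module. Let $G_R$ denote $G$ regarded as a right $R$-module through $f$, and regard $G_R\otimes_R S$ as a right $S$-module. Then the following are equivalent: 1. $G_R$ is a Gorenstein $(n,d)$-flat right $R$-module; 2. $G_R\otimes_R S$ is a Gorenstein $(n,d)$-flat right $S$-module; 3.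 $G$ is a Gorenstein $(n,d)$-flat right $S$-module. -/

import Mathlib

open CategoryTheory CategoryTheory.Limits
open scoped TensorProduct

universe u

/-! Throughout, right `R`-modules are modules over `Rᵐᵒᵖ`, and `m · r` is written
`MulOpposite.op r • m`. Rings are associative and unital, not necessarily commutative. -/

namespace GorFlat

section Tensor

variable (R : Type u) [Ring R]

/-- The relations `(m · r) ⊗ n = m ⊗ (r · n)` in `M ⊗_ℤ N`. -/
def balancedRel (M : Type u) [AddCommGroup M] [Module Rᵐᵒᵖ M]
    (N : Type u) [AddCommGroup N] [Module R N] : AddSubgroup (M ⊗[ℤ] N) :=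
  AddSubgroup.closure
    {x | ∃ (m : M) (r : R) (n : N),
      x = (MulOpposite.op r • m) ⊗ₜ[ℤ] n - m ⊗ₜ[ℤ] (r • n)}

/-- The tensor product `M ⊗_R N` of a right and a left module over a (noncommutative) ring `R`,
an abelian group. -/
def Tensor (M : Type u) [AddCommGroup M] [Module Rᵐᵒᵖ M]
    (N : Type u) [AddCommGroup N] [Module R N] : Type u :=
  (M ⊗[ℤ] N) ⧸ balancedRel R M N

variable (M : Type u) [AddCommGroup M] [Module Rᵐᵒᵖ M]
variable (N : Type u) [AddCommGroup N] [Module R N]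

instance Tensor.instAddCommGroup : AddCommGroup (Tensor R M N) :=
  inferInstanceAs (AddCommGroup ((M ⊗[ℤ] N) ⧸ balancedRel R M N))

/-- The quotient map `M ⊗_ℤ N → M ⊗_R N`. -/
def Tensor.mk : M ⊗[ℤ] N →+ Tensor R M N := QuotientAddGroup.mk' (balancedRel R M N)

variable {M N}

/-- The pure tensor `m ⊗ n` in `M ⊗_R N`. -/
def Tensor.tmul (m : M) (n : N) : Tensor R M N := Tensor.mk R M N (m ⊗ₜ[ℤ] n)

variable {R}
variable {M' M'' : Type u} [AddCommGroup M'] [Module Rᵐᵒᵖ M'] [AddCommGroup M''] [Module Rᵐᵒᵖ M'']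
variable {N' N'' : Type u} [AddCommGroup N'] [Module R N'] [AddCommGroup N''] [Module R N'']

/-- The homomorphism `g ⊗ h : M ⊗_R N → M' ⊗_R N'`. -/
def Tensor.map (g : M →ₗ[Rᵐᵒᵖ] M') (h : N →ₗ[R] N') : Tensor R M N →+ Tensor R M' N' :=
  QuotientAddGroup.map (balancedRel R M N) (balancedRel R M' N')
    (TensorProduct.map g.toAddMonoidHom.toIntLinearMap
      h.toAddMonoidHom.toIntLinearMap).toAddMonoidHom (by
    rw [balancedRel, AddSubgroup.closure_le]
    rintro x ⟨m, r, n, rfl⟩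
    refine AddSubgroup.subset_closure ⟨g m, r, h n, ?_⟩
    simp)

@[simp]
theorem Tensor.map_tmul (g : M →ₗ[Rᵐᵒᵖ] M') (h : N →ₗ[R] N') (m : M) (n : N) :
    Tensor.map g h (Tensor.tmul R m n) = Tensor.tmul R (g m) (h n) := rfl

/-- Additive maps out of `M ⊗_R N` are determined by their values on pure tensors. -/
theorem Tensor.hom_ext {A : Type*} [AddCommGroup A] {φ ψ : Tensor R M N →+ A}
    (H : ∀ (m : M) (n : N), φ (Tensor.tmul R m n) = ψ (Tensor.tmul R m n)) : φ = ψ := by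
  refine QuotientAddGroup.addMonoidHom_ext _ ?_
  ext x
  induction x using TensorProduct.induction_on with
  | zero => simp
  | tmul m n => exact H m n
  | add x y hx hy => rw [map_add, map_add, hx, hy]

theorem Tensor.tmul_add (m : M) (n n' : N) :
    Tensor.tmul R m (n + n') = Tensor.tmul R m n + Tensor.tmul R m n' := by
  simp [Tensor.tmul, TensorProduct.tmul_add]

theorem Tensor.add_tmul (m m' : M) (n : N) :
    Tensor.tmul R (m + m') n = Tensor.tmul R m n + Tensor.tmul R m' n := by
  simp [Tensor.tmul, TensorProduct.add_tmul]

theorem Tensor.tmul_zero (m : M) : Tensor.tmul R m (0 : N) = 0 := by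
  simp [Tensor.tmul]

theorem Tensor.map_id : Tensor.map (LinearMap.id : M →ₗ[Rᵐᵒᵖ] M) (LinearMap.id : N →ₗ[R] N) =
    AddMonoidHom.id _ :=
  Tensor.hom_ext fun _ _ => rfl

theorem Tensor.map_comp (g' : M' →ₗ[Rᵐᵒᵖ] M'') (g : M →ₗ[Rᵐᵒᵖ] M') (h' : N' →ₗ[R] N'')
    (h : N →ₗ[R] N') :
    Tensor.map (g' ∘ₗ g) (h' ∘ₗ h) = (Tensor.map g' h').comp (Tensor.map g h) :=
  Tensor.hom_ext fun _ _ => rfl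

theorem Tensor.map_add_left (g g' : M →ₗ[Rᵐᵒᵖ] M') (h : N →ₗ[R] N') :
    Tensor.map (g + g') h = Tensor.map g h + Tensor.map g' h :=
  Tensor.hom_ext fun m n => Tensor.add_tmul (g m) (g' m) (h n)

/-- Right multiplication by `s` on an `(R, S)`-bimodule. -/
def rightMul (R : Type u) [Ring R] {S : Type u} [Ring S] (N : Type u) [AddCommGroup N]
    [Module R N] [Module Sᵐᵒᵖ N] [SMulCommClass R Sᵐᵒᵖ N] (s : Sᵐᵒᵖ) : N →ₗ[R] N where
  toFun n := s • n
  map_add' := smul_add s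
  map_smul' r x := (smul_comm r s x).symm

/-- For an `(R, S)`-bimodule `N`, the group `M ⊗_R N` is a right `S`-module through
`(m ⊗ n) · s = m ⊗ (n · s)`. -/
instance Tensor.instRightModule {S : Type u} [Ring S] [Module Sᵐᵒᵖ N] [SMulCommClass R Sᵐᵒᵖ N] :
    Module Sᵐᵒᵖ (Tensor R M N) where
  smul s x := Tensor.map (LinearMap.id : M →ₗ[Rᵐᵒᵖ] M) (rightMul R N s) x
  one_smul x := by
    have H : Tensor.map (LinearMap.id : M →ₗ[Rᵐᵒᵖ] M) (rightMul R N (1 : Sᵐᵒᵖ)) =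
        AddMonoidHom.id _ :=
      Tensor.hom_ext fun m n => by simp [rightMul]
    exact DFunLike.congr_fun H x
  mul_smul s t x := by
    have H : Tensor.map (LinearMap.id : M →ₗ[Rᵐᵒᵖ] M) (rightMul R N (s * t)) =
        (Tensor.map LinearMap.id (rightMul R N s)).comp
          (Tensor.map LinearMap.id (rightMul R N t)) :=
      Tensor.hom_ext fun m n => by simp [rightMul, mul_smul]
    exact DFunLike.congr_fun H x
  smul_zero s := map_zero (Tensor.map _ (rightMul R N s))
  smul_add s := map_add (Tensor.map _ (rightMul R N s))
  add_smul s t x := by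
    have H : Tensor.map (LinearMap.id : M →ₗ[Rᵐᵒᵖ] M) (rightMul R N (s + t)) =
        Tensor.map LinearMap.id (rightMul R N s) + Tensor.map LinearMap.id (rightMul R N t) :=
      Tensor.hom_ext fun m n => by simp [rightMul, add_smul, Tensor.tmul_add]
    exact DFunLike.congr_fun H x
  zero_smul x := by
    have H : Tensor.map (LinearMap.id : M →ₗ[Rᵐᵒᵖ] M) (rightMul R N (0 : Sᵐᵒᵖ)) = 0 :=
      Tensor.hom_ext fun m n => by simp [rightMul, Tensor.tmul_zero]
    exact DFunLike.congr_fun H x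

end Tensor

section Tor

variable {R : Type u} [Ring R]

/-- The functor `- ⊗_R U` from right `R`-modules to abelian groups, for a left `R`-module `U`. -/
def tensorFunctor (U : ModuleCat.{u} R) : ModuleCat.{u} Rᵐᵒᵖ ⥤ AddCommGrpCat.{u} where
  obj M := AddCommGrpCat.of (Tensor R M U)
  map g := AddCommGrpCat.ofHom (Tensor.map g.hom (LinearMap.id : U →ₗ[R] U))
  map_id M := by
    rw [ModuleCat.hom_id, Tensor.map_id]
    rfl
  map_comp g h := by
    rw [← AddCommGrpCat.ofHom_comp, ← Tensor.map_comp, ModuleCat.hom_comp, LinearMap.id_comp]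

instance tensorFunctor_additive (U : ModuleCat.{u} R) : (tensorFunctor U).Additive where
  map_add {M M' g h} := by
    change AddCommGrpCat.ofHom (Tensor.map (g + h).hom _) = _
    rw [ModuleCat.hom_add, Tensor.map_add_left]
    rfl

/-- `M ↦ Tor_i^R(M, U)` as a functor of the right module `M`, the `i`-th left derived functor of
`- ⊗_R U`, for a left `R`-module `U`. -/
noncomputable def torFunctor (i : ℕ) (U : ModuleCat.{u} R) :
    ModuleCat.{u} Rᵐᵒᵖ ⥤ AddCommGrpCat.{u} :=
  (tensorFunctor U).leftDerived i

instance torFunctor_preservesZeroMorphisms (i : ℕ) (U : ModuleCat.{u} R) :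
    (torFunctor i U).PreservesZeroMorphisms where
  map_zero M M' := by
    unfold torFunctor
    rw [Functor.leftDerived_map_eq (tensorFunctor U) i (0 : M ⟶ M')
      (P := projectiveResolution M) (Q := projectiveResolution M') 0 (by simp)]
    rw [Functor.map_zero, zero_comp, comp_zero]

/-- A left `R`-module `U` is flat if `- ⊗_R U` preserves injectivity. -/
def IsFlatLeft (U : ModuleCat.{u} R) : Prop :=
  ∀ (M M' : ModuleCat.{u} Rᵐᵒᵖ) (g : M →ₗ[Rᵐᵒᵖ] M'), Function.Injective g →
    Function.Injective (Tensor.map g (LinearMap.id : U →ₗ[R] U))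

/-- `U` has finite flat dimension: there are `m` and an exact sequence
`0 → F m → ⋯ → F 1 → F 0 → U → 0` with every `F i` flat. -/
def HasFiniteFlatDim (U : ModuleCat.{u} R) : Prop :=
  ∃ (m : ℕ) (F : ℕ → ModuleCat.{u} R) (δ : ∀ i, F (i + 1) →ₗ[R] F i) (ε : F 0 →ₗ[R] U),
    (∀ i, IsFlatLeft (F i)) ∧ (∀ i, m < i → Subsingleton (F i)) ∧
    Function.Surjective ε ∧ Function.Exact (δ 0) ε ∧
    ∀ i, Function.Exact (δ (i + 1)) (δ i)

/-- `U` is `n`-presented: there is an exact sequence `F n → F (n-1) → ⋯ → F 0 → U → 0` with every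
`F i`, `i ≤ n`, finitely generated and free. (Nothing is asked of `F i` and `δ i` outside
this sequence; for `n = 0` the sequence is `F 0 → U → 0`.) -/
def IsNPresented (n : ℕ) (U : ModuleCat.{u} R) : Prop :=
  ∃ (F : ℕ → ModuleCat.{u} R) (δ : ∀ i, F (i + 1) →ₗ[R] F i) (ε : F 0 →ₗ[R] U),
    (∀ i ≤ n, Module.Free R (F i) ∧ Module.Finite R (F i)) ∧
    Function.Surjective ε ∧ (1 ≤ n → Function.Exact (δ 0) ε) ∧
    ∀ i, i + 2 ≤ n → Function.Exact (δ (i + 1)) (δ i)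

/-- A right `R`-module `M` is `(n, d)`-flat if `Tor_{d+1}^R(M, U) = 0` for every `n`-presented
left `R`-module `U`. -/
def IsNDFlat (n d : ℕ) (M : ModuleCat.{u} Rᵐᵒᵖ) : Prop :=
  ∀ U : ModuleCat.{u} R, IsNPresented n U → IsZero ((torFunctor (d + 1) U).obj M)

/-- A right `R`-module `G` is Gorenstein `(n, d)`-flat: there is an exact sequence of
`(n, d)`-flat right modules `⋯ → F₁ → F₀ → F⁰ → F¹ → ⋯` with `G ≅ ker (F⁰ → F¹)`, which stays exact
under `Tor_d^R(-, U)` for every `n`-presented left module `U` of finite flat dimension.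
In the `ℤ`-indexed complex `F`, the module `Fⁱ` is `F.X i` and `Fᵢ` is `F.X (-1 - i)`. -/
def IsGorensteinNDFlat (n d : ℕ) (G : ModuleCat.{u} Rᵐᵒᵖ) : Prop :=
  ∃ F : CochainComplex (ModuleCat.{u} Rᵐᵒᵖ) ℤ,
    (∀ i, IsNDFlat n d (F.X i)) ∧
    F.Acyclic ∧
    Nonempty (G ≅ ModuleCat.of Rᵐᵒᵖ (LinearMap.ker (F.d 0 1).hom)) ∧
    ∀ U : ModuleCat.{u} R, IsNPresented n U → HasFiniteFlatDim U →
      (((torFunctor d U).mapHomologicalComplex (ComplexShape.up ℤ)).obj F).Acyclic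

/-- For a ring homomorphism `f : R → S` and a right `R`-module `M`, the right `S`-module
`M ⊗_R S`, where `R` acts on `S` from the left through `f` and `S` acts on itself from the
right. -/
def extendRight {S : Type u} [Ring S] (f : R →+* S) (M : ModuleCat.{u} Rᵐᵒᵖ) :
    ModuleCat.{u} Sᵐᵒᵖ :=
  letI : Module R S := Module.compHom S f
  haveI : SMulCommClass R Sᵐᵒᵖ S := ⟨fun r s x => by
    change f r * (x * s.unop) = (f r * x) * s.unop
    rw [mul_assoc]⟩
  ModuleCat.of Sᵐᵒᵖ (Tensor R M S)

end Tor

end GorFlat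

/-! Split the surjection `f` as a map of left and of right `R`-modules. The images of `1` under the
two sections are elements over `1`, one annihilating `ker f` from the left and one from the right.
They coincide and form a central idempotent `c` with `ker f = (1 - c) R`, so `S` is a direct factor
of `R` (`exists_isCorner`).

Restriction along `f` and `U ↦ c U` are then adjoint to each other on both sides, hence exact and
projective-preserving. Since `N_R ⊗_R U ≅ N ⊗_S c U`, deriving gives `Tor^R_i(N_R, U) ≅ Tor^S_i(N, c
U)`, naturally in `N` (`restrictTorIso`), and makes `Tor^S_i(M c, V)` a natural retract of
`Tor^R_i(M, V_R)`. Both the vanishing and the exactness conditions therefore transfer, provided that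
`U ↦ c U` and `V ↦ V_R` preserve the test modules.

The delicate point is that `V_R` is again `n`-presented: `S` is projective over `R` but need not be
free. `IsNPresented.of_corner` covers by free modules and carries the excess `(1 - c)`-part from one
syzygy to the next. Finally, (2) and (3) are equivalent because `G_R ⊗_R S ≅ G` for surjective `f`.
-/

namespace GorFlat

/-! ### Direct factors of a ring and central idempotents -/

/-- A surjective ring homomorphism `f : A → B` whose kernel is generated by the central idempotent
`1 - c`; such an `f` is the projection onto a direct factor of the ring `A`. -/
structure IsCorner {A B : Type u} [Ring A] [Ring B] (f : A →+* B) (c : A) : Prop where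
  surj : Function.Surjective f
  central : ∀ a, c * a = a * c
  map_unit : f c = 1
  unit_mul : ∀ a, f a = 0 → c * a = 0

/-- `V` is a `B`-module, `U` is an `A`-module, and `j` identifies `V` with the direct summand
`c • U` of `U`, onto which `p` is the projection. -/
structure CornerPair {A B : Type u} [Ring A] [Ring B] (f : A →+* B) (c : A)
    (U : Type u) [AddCommGroup U] [Module A U] (V : Type u) [AddCommGroup V] [Module B V] where
  p : U →+ V
  j : V →+ U
  p_smul : ∀ (a : A) (u : U), p (a • u) = f a • p u
  j_smul : ∀ (a : A) (v : V), j (f a • v) = a • j v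
  p_j : ∀ v, p (j v) = v
  j_p : ∀ u, j (p u) = c • u

variable {A B : Type u} [Ring A] [Ring B] {f : A →+* B} {c : A}

/-- The direct factor onto which `A` is projected by `f` also describes the opposite rings. -/
theorem IsCorner.op (h : IsCorner f c) : IsCorner (RingHom.op f) (MulOpposite.op c) where
  surj b := by
    obtain ⟨a, ha⟩ := h.surj b.unop
    exact ⟨MulOpposite.op a, MulOpposite.unop_injective ha⟩
  central a := MulOpposite.unop_injective (h.central a.unop).symm
  map_unit := MulOpposite.unop_injective h.map_unit
  unit_mul a ha := by
    refine MulOpposite.unop_injective ?_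
    change a.unop * c = 0
    rw [← h.central]
    exact h.unit_mul _ (congrArg MulOpposite.unop ha)

theorem IsCorner.unit_mul_eq (h : IsCorner f c) {a b : A} (hab : f a = f b) : c * a = c * b := by
  rw [← sub_eq_zero, ← mul_sub]
  exact h.unit_mul _ (by rw [map_sub, hab, sub_self])

theorem IsCorner.idem (h : IsCorner f c) : c * c = c := by
  have := h.unit_mul_eq (a := c) (b := 1) (by rw [h.map_unit, map_one])
  rwa [mul_one] at this

theorem IsCorner.unit_smul_smul (h : IsCorner f c) {U : Type u} [AddCommGroup U] [Module A U]
    (u : U) : c • c • u = c • u := by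
  rw [smul_smul, h.idem]

theorem IsCorner.unit_smul_comm (h : IsCorner f c) {U : Type u} [AddCommGroup U] [Module A U]
    (a : A) (u : U) : c • a • u = a • c • u := by
  rw [smul_smul, smul_smul, h.central]

/-! ### The summand `c U` as a module over the factor ring -/

section Corner

variable (h : IsCorner f c) (U : Type u) [AddCommGroup U] [Module A U]

/-- The direct summand `c • U` of `U`. -/
def IsCorner.cornerSubmodule : Submodule A U where
  carrier := {u | c • u = u}
  add_mem' {u v} hu hv := by
    change c • (u + v) = u + v
    rw [smul_add, hu, hv]
  zero_mem' := smul_zero c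
  smul_mem' a u hu := by
    change c • a • u = a • u
    rw [h.unit_smul_comm, hu]

/-- The direct summand `c • U` of `U`, as a `B`-module. -/
def IsCorner.Corner : Type u := h.cornerSubmodule U

instance : AddCommGroup (h.Corner U) := inferInstanceAs (AddCommGroup (h.cornerSubmodule U))

instance IsCorner.instModuleBase : Module A (h.Corner U) :=
  inferInstanceAs (Module A (h.cornerSubmodule U))

variable {U}

theorem IsCorner.corner_unit_smul (x : h.Corner U) : c • x = x := Subtype.ext x.2

/-- As `c` acts as the identity on the corner and annihilates `ker f`, the `A`-action factors
through `B`; this makes the choice of preimages in the `B`-action harmless. -/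
theorem IsCorner.corner_smul_congr {a b : A} (hab : f a = f b) (x : h.Corner U) :
    a • x = b • x := by
  rw [← h.corner_unit_smul x, smul_smul, smul_smul, ← h.central, ← h.central, h.unit_mul_eq hab]

variable (U)

noncomputable instance : SMul B (h.Corner U) := ⟨fun b x => Function.surjInv h.surj b • x⟩

variable {U}

theorem IsCorner.corner_map_smul (a : A) (x : h.Corner U) : f a • x = a • x :=
  h.corner_smul_congr (Function.surjInv_eq h.surj (f a)) x

variable (U)

noncomputable instance : Module B (h.Corner U) :=
  Function.Surjective.moduleLeft f h.surj h.corner_map_smul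

/-- The corner `c • U` of an `A`-module `U`, together with its inclusion and projection. -/
def IsCorner.cornerPair : CornerPair f c U (h.Corner U) where
  p := AddMonoidHom.mk' (fun u => ⟨c • u, h.unit_smul_smul u⟩)
    fun u v => Subtype.ext (smul_add c u v)
  j := (h.cornerSubmodule U).subtype.toAddMonoidHom
  p_smul a u := by
    rw [h.corner_map_smul]
    exact Subtype.ext (h.unit_smul_comm a u)
  j_smul a v := by rw [h.corner_map_smul]; rfl
  p_j v := Subtype.ext v.2
  j_p u := rfl

/-- A `B`-module restricted along `f` has itself as its corner. -/
def IsCorner.restrictPair (h : IsCorner f c) (V : ModuleCat.{u} B) :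
    CornerPair f c ((ModuleCat.restrictScalars f).obj V) V where
  p := AddMonoidHom.id V
  j := AddMonoidHom.id V
  p_smul _ _ := rfl
  j_smul _ _ := rfl
  p_j _ := rfl
  j_p v := by
    change v = f c • v
    rw [h.map_unit, one_smul]

end Corner

/-! ### Calculus of corners, up to isomorphism -/

namespace CornerPair

variable {U V U' V' : Type u} [AddCommGroup U] [Module A U] [AddCommGroup V] [Module B V]
  [AddCommGroup U'] [Module A U'] [AddCommGroup V'] [Module B V']

theorem j_injective (P : CornerPair f c U V) : Function.Injective P.j :=
  Function.LeftInverse.injective P.p_j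

theorem unit_smul_j (P : CornerPair f c U V) (v : V) : c • P.j v = P.j v := by
  rw [← P.j_p, P.p_j]

theorem p_unit_smul (P : CornerPair f c U V) (u : U) : P.p (c • u) = P.p u := by
  rw [← P.j_p, P.p_j]

/-- The `B`-linear map between corners induced by an `A`-linear map. -/
def map (h : IsCorner f c) (P : CornerPair f c U V) (P' : CornerPair f c U' V')
    (g : U →ₗ[A] U') : V →ₗ[B] V' where
  toFun v := P'.p (g (P.j v))
  map_add' v w := by simp
  map_smul' b v := by
    obtain ⟨a, rfl⟩ := h.surj b
    simp [P.j_smul, P'.p_smul]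

theorem map_apply (h : IsCorner f c) (P : CornerPair f c U V) (P' : CornerPair f c U' V')
    (g : U →ₗ[A] U') (v : V) : P.map h P' g v = P'.p (g (P.j v)) := rfl

theorem map_p (h : IsCorner f c) (P : CornerPair f c U V) (P' : CornerPair f c U' V')
    (g : U →ₗ[A] U') (u : U) : P.map h P' g (P.p u) = P'.p (g u) := by
  rw [map_apply, P.j_p, map_smul, p_unit_smul]

theorem j_map (h : IsCorner f c) (P : CornerPair f c U V) (P' : CornerPair f c U' V')
    (g : U →ₗ[A] U') (v : V) : P'.j (P.map h P' g v) = g (P.j v) := by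
  rw [map_apply, P'.j_p, ← map_smul, P.unit_smul_j]

theorem map_surjective (h : IsCorner f c) (P : CornerPair f c U V) (P' : CornerPair f c U' V')
    {g : U →ₗ[A] U'} (hg : Function.Surjective g) : Function.Surjective (P.map h P' g) := by
  intro w
  obtain ⟨u, hu⟩ := hg (P'.j w)
  exact ⟨P.p u, by rw [map_p, hu, P'.p_j]⟩

theorem map_injective (h : IsCorner f c) (P : CornerPair f c U V) (P' : CornerPair f c U' V')
    {g : U →ₗ[A] U'} (hg : Function.Injective g) : Function.Injective (P.map h P' g) := by
  intro v w hvw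
  have := congrArg P'.j hvw
  rw [j_map, j_map] at this
  exact P.j_injective (hg this)

/-- Both `p` and `j` commute with the induced maps, so a preimage is found in `U` for `P'.j v` and
projected back to `V`. -/
theorem map_exact (h : IsCorner f c) (P : CornerPair f c U V) (P' : CornerPair f c U' V')
    {U'' V'' : Type u} [AddCommGroup U''] [Module A U''] [AddCommGroup V''] [Module B V'']
    (P'' : CornerPair f c U'' V'')
    {g : U →ₗ[A] U'} {g' : U' →ₗ[A] U''} (hg : Function.Exact g g') :
    Function.Exact (P.map h P' g) (P'.map h P'' g') := by
  intro v
  constructor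
  · intro hv
    obtain ⟨u, hu⟩ := (hg (P'.j v)).1 (by rw [← j_map h P' P'', hv, map_zero])
    exact ⟨P.p u, by rw [map_p, hu, P'.p_j]⟩
  · rintro ⟨w, rfl⟩
    apply P''.j_injective
    rw [j_map, j_map, map_zero]
    exact (hg _).2 ⟨_, rfl⟩

/-- Two corners of the same module are isomorphic. -/
def equiv (h : IsCorner f c) (P : CornerPair f c U V) (P' : CornerPair f c U V') : V ≃ₗ[B] V' :=
  LinearEquiv.ofLinearMap (P.map h P' LinearMap.id) (P'.map h P LinearMap.id)
    (LinearMap.ext fun v => by simp [map_apply, P.j_p, P'.p_unit_smul, P'.p_j])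
    (LinearMap.ext fun v => by simp [map_apply, P'.j_p, P.p_unit_smul, P.p_j])

/-- The corner of the free module `ι → A` is `ι → B`. -/
noncomputable def pi (h : IsCorner f c) (ι : Type u) : CornerPair f c (ι → A) (ι → B) where
  p := AddMonoidHom.mk' (fun x i => f (x i)) fun x y => by ext; simp
  -- A chosen preimage is determined only modulo `ker f`; the factor `c` removes the ambiguity and
  -- makes the map additive.
  j := AddMonoidHom.mk' (fun y i => c * Function.surjInv h.surj (y i)) fun x y => by
    ext i
    simp only [Pi.add_apply]
    rw [← mul_add]
    exact h.unit_mul_eq (by simp [Function.surjInv_eq])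
  p_smul a x := by ext; simp
  j_smul a y := by
    ext i
    simp only [AddMonoidHom.mk'_apply, Pi.smul_apply, smul_eq_mul]
    rw [← mul_assoc a, ← h.central, mul_assoc]
    exact h.unit_mul_eq (by simp [Function.surjInv_eq])
  p_j y := by
    ext i
    simp [Function.surjInv_eq, h.map_unit]
  j_p x := by
    ext i
    exact h.unit_mul_eq (by simp [Function.surjInv_eq])

/-- The corner of a submodule, as a submodule of the corner. -/
def submodule (P : CornerPair f c U V) (K : Submodule A U) (L : Submodule B V)
    (hp : ∀ u ∈ K, P.p u ∈ L) (hj : ∀ v ∈ L, P.j v ∈ K) : CornerPair f c K L where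
  p := AddMonoidHom.mk' (fun u => ⟨P.p u, hp u u.2⟩) fun _ _ => Subtype.ext (map_add P.p _ _)
  j := AddMonoidHom.mk' (fun v => ⟨P.j v, hj v v.2⟩) fun _ _ => Subtype.ext (map_add P.j _ _)
  p_smul a u := Subtype.ext (P.p_smul a u)
  j_smul a v := Subtype.ext (P.j_smul a v)
  p_j v := Subtype.ext (P.p_j v)
  j_p u := Subtype.ext (P.j_p u)

end CornerPair

/-! ### The central idempotent from two-sided projectivity -/

theorem exists_isCorner {R S : Type u} [Ring R] [Ring S] (f : R →+* S)
    (hf : Function.Surjective f)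
    (hleft : Module.Projective R ((ModuleCat.restrictScalars f).obj (ModuleCat.of S S)))
    (hright : Module.Projective Rᵐᵒᵖ
      ((ModuleCat.restrictScalars (RingHom.op f)).obj (ModuleCat.of Sᵐᵒᵖ S))) :
    ∃ c, IsCorner f c := by
  -- For a section `s` of the left-linear map `f`, take `c = s 1`: then `r * c = s (f r)`, which
  -- vanishes on `ker f`.
  obtain ⟨c, hc, hcl⟩ : ∃ c, f c = 1 ∧ ∀ r, f r = 0 → r * c = 0 := by
    let φ : R →ₗ[R] ((ModuleCat.restrictScalars f).obj (ModuleCat.of S S)) :=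
      { toFun := fun r => (f r : S)
        map_add' := map_add f
        map_smul' := map_mul f }
    obtain ⟨s, hs⟩ := Module.projective_lifting_property φ LinearMap.id hf
    let one : ((ModuleCat.restrictScalars f).obj (ModuleCat.of S S)) := (1 : S)
    refine ⟨s one, LinearMap.congr_fun hs one, fun r hr => ?_⟩
    have h0 : r • one = 0 := by
      change f r * 1 = 0
      rw [hr, zero_mul]
    rw [← smul_eq_mul, ← map_smul, h0, map_zero]
  obtain ⟨e, he, her⟩ : ∃ e, f e = 1 ∧ ∀ r, f r = 0 → e * r = 0 := by
    let φ : R →ₗ[Rᵐᵒᵖ] ((ModuleCat.restrictScalars (RingHom.op f)).obj (ModuleCat.of Sᵐᵒᵖ S)) :=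
      { toFun := fun r => (f r : S)
        map_add' := map_add f
        map_smul' := fun a r => map_mul f r a.unop }
    obtain ⟨s, hs⟩ := Module.projective_lifting_property φ LinearMap.id hf
    let one : ((ModuleCat.restrictScalars (RingHom.op f)).obj (ModuleCat.of Sᵐᵒᵖ S)) := (1 : S)
    refine ⟨s one, LinearMap.congr_fun hs one, fun r hr => ?_⟩
    have h0 : MulOpposite.op r • one = 0 := by
      change 1 * f r = 0
      rw [hr, mul_zero]
    have h1 : s (MulOpposite.op r • one) = s one * r := map_smul s _ _
    rw [← h1, h0, map_zero]
  -- Both `1 - c` and `1 - e` lie in `ker f`, so `e = e * c = c`.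
  have hec : e = c := by
    have h1 := her (1 - c) (by simp [hc])
    have h2 := hcl (1 - e) (by simp [he])
    rw [mul_sub, mul_one, sub_eq_zero] at h1
    rw [sub_mul, one_mul, sub_eq_zero] at h2
    rw [h1, ← h2]
  subst hec
  refine ⟨e, hf, fun a => ?_, hc, her⟩
  -- Both differences lie in `ker f`, whence `a * e = e * a * e = e * a`.
  have h1 := hcl (a - e * a) (by simp [he])
  have h2 := her (a - a * e) (by simp [he])
  rw [sub_mul, sub_eq_zero] at h1
  rw [mul_sub, sub_eq_zero] at h2
  rw [h2, ← mul_assoc, ← h1]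

/-! ### Two-sided adjunction between restriction and corner -/

section Functors

variable {A B : Type u} [Ring A] [Ring B] {f : A →+* B} {c : A}

/-- The functor `U ↦ c • U` from `A`-modules to `B`-modules. -/
noncomputable def IsCorner.cornerFunctor (h : IsCorner f c) :
    ModuleCat.{u} A ⥤ ModuleCat.{u} B where
  obj U := ModuleCat.of B (h.Corner U)
  map {U U'} g := ModuleCat.ofHom ((h.cornerPair U).map h (h.cornerPair U') g.hom)
  map_id U := by
    ext v
    exact (h.cornerPair U).p_j v
  map_comp {U U' U''} g g' := by
    ext v
    apply (h.cornerPair U'').j_injective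
    simp [CornerPair.j_map]

instance (h : IsCorner f c) : h.cornerFunctor.Additive where
  map_add {U U' g g'} := by
    ext v
    exact map_add (h.cornerPair U').p _ _

/-- The inclusion `c • U → U`. -/
noncomputable def IsCorner.inclusion (h : IsCorner f c) :
    h.cornerFunctor ⋙ ModuleCat.restrictScalars f ⟶ 𝟭 (ModuleCat.{u} A) where
  app U := ModuleCat.ofHom
    (X := (ModuleCat.restrictScalars f).obj (h.cornerFunctor.obj U)) (Y := U)
    { toFun := (h.cornerPair U).j
      map_add' := map_add (h.cornerPair U).j
      map_smul' := (h.cornerPair U).j_smul }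
  naturality U U' g := by
    ext v
    exact (h.cornerPair U).j_map h (h.cornerPair U') g.hom v

/-- The projection `U → c • U`. -/
noncomputable def IsCorner.projection (h : IsCorner f c) :
    𝟭 (ModuleCat.{u} A) ⟶ h.cornerFunctor ⋙ ModuleCat.restrictScalars f where
  app U := ModuleCat.ofHom
    (X := U) (Y := (ModuleCat.restrictScalars f).obj (h.cornerFunctor.obj U))
    { toFun := (h.cornerPair U).p
      map_add' := map_add (h.cornerPair U).p
      map_smul' := (h.cornerPair U).p_smul }
  naturality U U' g := by
    ext u
    exact ((h.cornerPair U).map_p h (h.cornerPair U') g.hom u).symm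

theorem IsCorner.inclusion_projection (h : IsCorner f c) :
    h.inclusion ≫ h.projection = 𝟙 _ := by
  ext U v
  exact (h.cornerPair U).p_j v

/-- A `B`-module is the corner of its restriction along `f`. -/
noncomputable def IsCorner.restrictCornerIso (h : IsCorner f c) :
    𝟭 (ModuleCat.{u} B) ≅ ModuleCat.restrictScalars f ⋙ h.cornerFunctor :=
  NatIso.ofComponents
    (fun V => ((h.restrictPair V).equiv h (h.cornerPair _)).toModuleIso) fun {V V'} g => by
      ext v
      exact (((h.cornerPair ((ModuleCat.restrictScalars f).obj V)).map_p h
        (h.cornerPair ((ModuleCat.restrictScalars f).obj V'))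
        ((ModuleCat.restrictScalars f).map g).hom v)).symm

/-- Restriction along `f` is left adjoint to the corner functor. -/
noncomputable def IsCorner.restrictAdjunction (h : IsCorner f c) :
    ModuleCat.restrictScalars.{u} f ⊣ h.cornerFunctor :=
  Adjunction.mkOfUnitCounit
    { unit := h.restrictCornerIso.hom
      counit := h.inclusion
      left_triangle := by
        ext V v
        exact (h.restrictPair V).unit_smul_j v
      right_triangle := by
        ext U v
        apply (h.cornerPair U).j_injective
        refine ((h.cornerPair _).j_map h (h.cornerPair U) (h.inclusion.app U).hom _).trans ?_
        exact congrArg (h.cornerPair U).j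
          ((h.restrictPair (h.cornerFunctor.obj U)).unit_smul_j v) }

/-- Restriction along `f` is right adjoint to the corner functor. -/
noncomputable def IsCorner.cornerAdjunction (h : IsCorner f c) :
    h.cornerFunctor ⊣ ModuleCat.restrictScalars.{u} f :=
  Adjunction.mkOfUnitCounit
    { unit := h.projection
      counit := h.restrictCornerIso.inv
      left_triangle := by
        ext U v
        exact ((h.cornerPair U).j_map h (h.cornerPair _) (h.projection.app U).hom v).trans
          ((h.cornerPair U).p_j v)
      right_triangle := by
        ext V v
        exact (h.restrictPair V).unit_smul_j v }

instance (h : IsCorner f c) : PreservesFiniteLimits h.cornerFunctor :=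
  have := h.restrictAdjunction.rightAdjoint_preservesLimits
  inferInstance

instance (h : IsCorner f c) : PreservesFiniteColimits h.cornerFunctor :=
  have := h.cornerAdjunction.leftAdjoint_preservesColimits
  inferInstance

/-- Being both a left and a right adjoint, restriction preserves all limits and colimits. -/
theorem IsCorner.restrictScalars_preservesHomology (h : IsCorner f c) :
    (ModuleCat.restrictScalars.{u} f).PreservesHomology :=
  have := h.restrictAdjunction.leftAdjoint_preservesColimits
  have := h.cornerAdjunction.rightAdjoint_preservesLimits
  inferInstance

/-- A left adjoint of a functor preserving epimorphisms preserves projectives. -/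
theorem IsCorner.restrictScalars_preservesProjectiveObjects (h : IsCorner f c) :
    (ModuleCat.restrictScalars.{u} f).PreservesProjectiveObjects where
  projective_obj hP := h.restrictAdjunction.map_projective _ hP

theorem IsCorner.restrict_unit_smul (h : IsCorner f c) (V : ModuleCat.{u} B)
    (v : (ModuleCat.restrictScalars f).obj V) : c • v = v :=
  ((h.restrictPair V).j_p v).symm

end Functors

/-! ### Derived functors of a composite with an exact functor -/

section DerivedFunctors

variable {C D E : Type*} [Category* C] [Category* D] [Category* E] [Abelian C] [Abelian D]
  [Abelian E] [HasProjectiveResolutions C] [HasProjectiveResolutions D]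

/-- The left derived functors of `G ⋙ F`, where `G` is exact and preserves projective objects. -/
noncomputable def leftDerivedCompIso (G : C ⥤ D) [G.Additive] [G.PreservesProjectiveObjects]
    [G.PreservesHomology] (F : D ⥤ E) [F.Additive] (n : ℕ) :
    G ⋙ F.leftDerived n ≅ (G ⋙ F).leftDerived n :=
  NatIso.ofComponents (fun X =>
    (G.mapProjectiveResolution (projectiveResolution X)).isoLeftDerivedObj F n ≪≫
      ((projectiveResolution X).isoLeftDerivedObj (G ⋙ F) n).symm) fun {X Y} g => by
    -- If `φ` lifts `g` to resolutions, its image under `G` lifts `G.map g` to the image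
    -- resolutions, so one lift computes both sides of the square.
    let P := projectiveResolution X
    let Q := projectiveResolution Y
    let φ := ProjectiveResolution.lift g P Q
    have hφ : φ.f 0 ≫ Q.π.f 0 = P.π.f 0 ≫ g := ProjectiveResolution.lift_commutes_zero g P Q
    have h1 := ProjectiveResolution.isoLeftDerivedObj_hom_naturality (G.map g)
      (G.mapProjectiveResolution P) (G.mapProjectiveResolution Q)
      ((G.mapHomologicalComplex _).map φ) (by
        simp [Functor.mapProjectiveResolution,
          HomologicalComplex.singleMapHomologicalComplex_hom_app_self]
        exact (congrArg (_ ≫ ·) (Category.comp_id _)).trans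
          (((G.map_comp _ _).symm.trans ((congrArg G.map hφ).trans (G.map_comp _ _))).trans
            (congrArg (· ≫ _) (Category.comp_id _).symm))) F n
    have h2 := ProjectiveResolution.isoLeftDerivedObj_inv_naturality g P Q φ hφ (G ⋙ F) n
    exact (Category.assoc _ _ _).symm.trans ((congrArg (· ≫ _) h1).trans
      ((Category.assoc _ _ _).trans ((congrArg (_ ≫ ·) h2.symm).trans
        (Category.assoc _ _ _).symm)))

/-- Isomorphic functors have isomorphic left derived functors. -/
noncomputable def leftDerivedMapIso {F G : C ⥤ D} [F.Additive] [G.Additive] (α : F ≅ G) (n : ℕ) :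
    F.leftDerived n ≅ G.leftDerived n where
  hom := NatTrans.leftDerived α.hom n
  inv := NatTrans.leftDerived α.inv n
  hom_inv_id := by rw [← NatTrans.leftDerived_comp, α.hom_inv_id, NatTrans.leftDerived_id]
  inv_hom_id := by rw [← NatTrans.leftDerived_comp, α.inv_hom_id, NatTrans.leftDerived_id]

end DerivedFunctors

/-! ### Universal property of the balanced tensor product -/

section Tensor

variable {R : Type u} [Ring R] {M : Type u} [AddCommGroup M] [Module Rᵐᵒᵖ M]
  {N : Type u} [AddCommGroup N] [Module R N]

/-- The additive map out of `M ⊗_R N` given by a balanced biadditive map. -/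
def Tensor.lift {X : Type*} [AddCommGroup X] (φ : M →+ N →+ X)
    (hφ : ∀ m (r : R) n, φ (MulOpposite.op r • m) n = φ m (r • n)) : Tensor R M N →+ X :=
  QuotientAddGroup.lift (balancedRel R M N) (TensorProduct.liftAddHom φ fun k m n => by simp) (by
    rw [balancedRel, AddSubgroup.closure_le]
    rintro x ⟨m, r, n, rfl⟩
    simp [hφ])

theorem Tensor.smul_tmul (m : M) (r : R) (n : N) :
    Tensor.tmul R (MulOpposite.op r • m) n = Tensor.tmul R m (r • n) := by
  rw [← sub_eq_zero]
  refine Eq.trans ?_ ((QuotientAddGroup.eq_zero_iff _).2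
    (AddSubgroup.subset_closure ⟨m, r, n, rfl⟩ :
      (MulOpposite.op r • m) ⊗ₜ[ℤ] n - m ⊗ₜ[ℤ] (r • n) ∈ balancedRel R M N))
  exact (map_sub (Tensor.mk R M N) _ _).symm

variable (R M N) in
/-- The universal balanced biadditive map. -/
def Tensor.tmulHom : M →+ N →+ Tensor R M N :=
  AddMonoidHom.mk' (fun m => AddMonoidHom.mk' (Tensor.tmul R m) (Tensor.tmul_add m))
    fun m m' => AddMonoidHom.ext (Tensor.add_tmul m m')

end Tensor

/-! ### Tensor products and Tor over the factor ring -/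

section TensorCorner

variable {R S : Type u} [Ring R] [Ring S] {f : R →+* S} {c : R}
  {M M' : Type u} [AddCommGroup M] [Module Rᵐᵒᵖ M] [AddCommGroup M'] [Module Sᵐᵒᵖ M']
  {U V : Type u} [AddCommGroup U] [Module R U] [AddCommGroup V] [Module S V]

/-- The map `M ⊗_R U → M c ⊗_S c U`. -/
def tensorCorner (Q : CornerPair (RingHom.op f) (MulOpposite.op c) M M')
    (P : CornerPair f c U V) : Tensor R M U →+ Tensor S M' V :=
  Tensor.lift (((Tensor.tmulHom S M' V).compl₂ P.p).comp Q.p) fun m r u => by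
    change Tensor.tmul S (Q.p _) (P.p u) = Tensor.tmul S (Q.p m) (P.p _)
    rw [Q.p_smul, P.p_smul]
    exact Tensor.smul_tmul _ _ _

/-- The map `M c ⊗_S c U → M ⊗_R U`. -/
def tensorCornerInv (h : IsCorner f c) (Q : CornerPair (RingHom.op f) (MulOpposite.op c) M M')
    (P : CornerPair f c U V) : Tensor S M' V →+ Tensor R M U :=
  Tensor.lift (((Tensor.tmulHom R M U).compl₂ P.j).comp Q.j) fun m s v => by
    obtain ⟨r, rfl⟩ := h.surj s
    change Tensor.tmul R (Q.j (RingHom.op f (MulOpposite.op r) • m)) (P.j v) =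
      Tensor.tmul R (Q.j m) (P.j _)
    rw [Q.j_smul, P.j_smul, Tensor.smul_tmul]

theorem tensorCorner_tmul (Q : CornerPair (RingHom.op f) (MulOpposite.op c) M M')
    (P : CornerPair f c U V) (m : M) (u : U) :
    tensorCorner Q P (Tensor.tmul R m u) = Tensor.tmul S (Q.p m) (P.p u) := rfl

theorem tensorCornerInv_tmul (h : IsCorner f c)
    (Q : CornerPair (RingHom.op f) (MulOpposite.op c) M M')
    (P : CornerPair f c U V) (m : M') (v : V) :
    tensorCornerInv h Q P (Tensor.tmul S m v) = Tensor.tmul R (Q.j m) (P.j v) := rfl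

theorem tensorCorner_comp_inv (h : IsCorner f c)
    (Q : CornerPair (RingHom.op f) (MulOpposite.op c) M M') (P : CornerPair f c U V) :
    (tensorCorner Q P).comp (tensorCornerInv h Q P) = AddMonoidHom.id _ :=
  Tensor.hom_ext fun m v => by
    rw [AddMonoidHom.comp_apply, tensorCornerInv_tmul, tensorCorner_tmul, Q.p_j, P.p_j]
    rfl

/-- The composite `M ⊗_R U → M c ⊗_S c U → M ⊗_R U` is the identity as soon as `M = M c`
or `U = c U`. -/
theorem tensorCornerInv_comp (h : IsCorner f c)
    (Q : CornerPair (RingHom.op f) (MulOpposite.op c) M M') (P : CornerPair f c U V)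
    (hc : (∀ m : M, MulOpposite.op c • m = m) ∨ ∀ u : U, c • u = u) :
    (tensorCornerInv h Q P).comp (tensorCorner Q P) = AddMonoidHom.id _ :=
  Tensor.hom_ext fun m u => by
    rw [AddMonoidHom.comp_apply, tensorCorner_tmul, tensorCornerInv_tmul, Q.j_p, P.j_p]
    -- The composite sends `m ⊗ u` to `m c ⊗ c u`; both factors `c` are moved to the side where `c`
    -- acts trivially.
    rcases hc with hc | hc
    · rw [← Tensor.smul_tmul, hc, hc]
      rfl
    · rw [Tensor.smul_tmul, hc, hc]
      rfl

/-- `N_R ⊗_R U ≅ N ⊗_S c U`, naturally in the right `S`-module `N`. -/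
noncomputable def restrictTensorIso (h : IsCorner f c) {U : ModuleCat.{u} R} {V : ModuleCat.{u} S}
    (P : CornerPair f c U V) :
    ModuleCat.restrictScalars (RingHom.op f) ⋙ tensorFunctor U ≅ tensorFunctor V :=
  NatIso.ofComponents (fun N =>
    { hom := AddCommGrpCat.ofHom (tensorCorner (h.op.restrictPair N) P)
      inv := AddCommGrpCat.ofHom (tensorCornerInv h (h.op.restrictPair N) P)
      hom_inv_id := AddCommGrpCat.hom_ext (tensorCornerInv_comp h _ _
          (Or.inl (h.op.restrict_unit_smul N)))
      inv_hom_id := AddCommGrpCat.hom_ext (tensorCorner_comp_inv h _ _) }) fun {N N'} g => by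
    ext x
    exact DFunLike.congr_fun (Tensor.hom_ext
      (φ := AddMonoidHom.comp (tensorCorner (h.op.restrictPair N') P) (Tensor.map _ _))
      (ψ := (Tensor.map _ _).comp (tensorCorner (h.op.restrictPair N) P)) fun _ _ => rfl) x

/-- `Tor^R_i(N_R, U) ≅ Tor^S_i(N, c U)`, naturally in the right `S`-module `N`. -/
noncomputable def restrictTorIso (h : IsCorner f c) {U : ModuleCat.{u} R} {V : ModuleCat.{u} S}
    (P : CornerPair f c U V) (i : ℕ) :
    ModuleCat.restrictScalars (RingHom.op f) ⋙ torFunctor i U ≅ torFunctor i V :=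
  haveI := h.op.restrictScalars_preservesHomology
  haveI := h.op.restrictScalars_preservesProjectiveObjects
  leftDerivedCompIso (ModuleCat.restrictScalars (RingHom.op f)) (tensorFunctor U) i ≪≫
    leftDerivedMapIso (restrictTensorIso h P) i

end TensorCorner

/-! ### Flatness and finite flat dimension -/

section Flat

variable {R S : Type u} [Ring R] [Ring S] {f : R →+* S} {c : R}

theorem tensorCorner_map (h : IsCorner f c) {M M' N N' U V : Type u}
    [AddCommGroup M] [Module Rᵐᵒᵖ M] [AddCommGroup M'] [Module Rᵐᵒᵖ M']
    [AddCommGroup N] [Module Sᵐᵒᵖ N] [AddCommGroup N'] [Module Sᵐᵒᵖ N']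
    [AddCommGroup U] [Module R U] [AddCommGroup V] [Module S V]
    (Q : CornerPair (RingHom.op f) (MulOpposite.op c) M N)
    (Q' : CornerPair (RingHom.op f) (MulOpposite.op c) M' N')
    (P : CornerPair f c U V) (g : M →ₗ[Rᵐᵒᵖ] M') :
    (tensorCorner Q' P).comp (Tensor.map g LinearMap.id) =
      (Tensor.map (Q.map h.op Q' g) LinearMap.id).comp (tensorCorner Q P) :=
  Tensor.hom_ext fun m u => by
    simp [tensorCorner_tmul, CornerPair.map_p]

theorem tensorCornerInv_map (h : IsCorner f c) {M M' N N' U V : Type u}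
    [AddCommGroup M] [Module Rᵐᵒᵖ M] [AddCommGroup M'] [Module Rᵐᵒᵖ M']
    [AddCommGroup N] [Module Sᵐᵒᵖ N] [AddCommGroup N'] [Module Sᵐᵒᵖ N']
    [AddCommGroup U] [Module R U] [AddCommGroup V] [Module S V]
    (Q : CornerPair (RingHom.op f) (MulOpposite.op c) M N)
    (Q' : CornerPair (RingHom.op f) (MulOpposite.op c) M' N')
    (P : CornerPair f c U V) (g : M →ₗ[Rᵐᵒᵖ] M') :
    (tensorCornerInv h Q' P).comp (Tensor.map (Q.map h.op Q' g) LinearMap.id) =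
      (Tensor.map g LinearMap.id).comp (tensorCornerInv h Q P) :=
  Tensor.hom_ext fun m u => by
    simp [tensorCornerInv_tmul, CornerPair.j_map]

/-- `N ⊗_S V` embeds naturally in `N_R ⊗_R U`, so injectivity of `g_R ⊗ U` forces that of `g ⊗ V`.
-/
theorem IsFlatLeft.corner (h : IsCorner f c) {U : ModuleCat.{u} R} {V : ModuleCat.{u} S}
    (P : CornerPair f c U V) (hU : IsFlatLeft U) : IsFlatLeft V := by
  intro N N' g hg
  let gR := ((ModuleCat.restrictScalars (RingHom.op f)).map (ModuleCat.ofHom g)).hom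
  have h1 := hU _ _ gR hg
  have h2 := tensorCornerInv_map h (h.op.restrictPair N) (h.op.restrictPair N') P gR
  have h3 : Function.Injective (tensorCornerInv h (h.op.restrictPair N) P) :=
    Function.LeftInverse.injective
      (DFunLike.congr_fun (tensorCorner_comp_inv h (h.op.restrictPair N) P))
  refine Function.Injective.of_comp (f := tensorCornerInv h (h.op.restrictPair N') P) ?_
  rw [← AddMonoidHom.coe_comp]
  change Function.Injective ((tensorCornerInv h (h.op.restrictPair N') P).comp
    (Tensor.map ((h.op.restrictPair N).map h.op (h.op.restrictPair N') gR) LinearMap.id))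
  rw [h2]
  exact h1.comp h3

/-- `M ⊗_R V_R` embeds naturally in `M c ⊗_S V`, and `M ↦ M c` preserves injections. -/
theorem IsFlatLeft.restrictScalars (h : IsCorner f c) {V : ModuleCat.{u} S} (hV : IsFlatLeft V) :
    IsFlatLeft ((ModuleCat.restrictScalars f).obj V) := by
  intro M M' g hg
  let Q := h.op.cornerPair M
  let Q' := h.op.cornerPair M'
  have h1 := hV (ModuleCat.of _ (h.op.Corner M)) (ModuleCat.of _ (h.op.Corner M'))
    (Q.map h.op Q' g) (Q.map_injective h.op Q' hg)
  have h2 := tensorCorner_map h Q Q' (h.restrictPair V) g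
  have h3 : Function.Injective (tensorCorner Q (h.restrictPair V)) :=
    Function.LeftInverse.injective
      (DFunLike.congr_fun (tensorCornerInv_comp h Q (h.restrictPair V)
        (Or.inr (h.restrict_unit_smul V))))
  refine Function.Injective.of_comp (f := tensorCorner Q' (h.restrictPair V)) ?_
  rw [← AddMonoidHom.coe_comp, h2]
  exact h1.comp h3

theorem HasFiniteFlatDim.corner (h : IsCorner f c) {U : ModuleCat.{u} R} {V : ModuleCat.{u} S}
    (P : CornerPair f c U V) (hU : HasFiniteFlatDim U) : HasFiniteFlatDim V := by
  obtain ⟨m, F, δ, ε, hF, hm, hε, h0, hδ⟩ := hU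
  refine ⟨m, fun i => ModuleCat.of S (h.Corner (F i)),
    fun i => (h.cornerPair (F (i + 1))).map h (h.cornerPair (F i)) (δ i),
    (h.cornerPair (F 0)).map h P ε, fun i => (hF i).corner h (h.cornerPair (F i)),
    fun i hi => ?_, CornerPair.map_surjective _ _ _ hε, CornerPair.map_exact _ _ _ _ h0,
    fun i => CornerPair.map_exact _ _ _ _ (hδ i)⟩
  have := hm i hi
  exact (h.cornerPair (F i)).j_injective.subsingleton

theorem HasFiniteFlatDim.restrictScalars (h : IsCorner f c) {V : ModuleCat.{u} S}
    (hV : HasFiniteFlatDim V) : HasFiniteFlatDim ((ModuleCat.restrictScalars f).obj V) := by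
  obtain ⟨m, F, δ, ε, hF, hm, hε, h0, hδ⟩ := hV
  exact ⟨m, fun i => (ModuleCat.restrictScalars f).obj (F i),
    fun i => ((ModuleCat.restrictScalars f).map (ModuleCat.ofHom (δ i))).hom,
    ((ModuleCat.restrictScalars f).map (ModuleCat.ofHom ε)).hom,
    fun i => (hF i).restrictScalars h, hm, hε, h0, hδ⟩

end Flat

/-! ### Finite presentations over `R` and over `S` -/

section Presented

variable {R : Type u} [Ring R]

theorem IsNPresented.of_equiv {n : ℕ} {U U' : ModuleCat.{u} R} (hU : IsNPresented n U)
    (e : U ≃ₗ[R] U') : IsNPresented n U' := by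
  obtain ⟨F, δ, ε, hF, hε, h0, hδ⟩ := hU
  refine ⟨F, δ, e.toLinearMap ∘ₗ ε, hF, e.surjective.comp hε, fun hn x => ?_, hδ⟩
  rw [← h0 hn x]
  simp

theorem isNPresented_zero_iff {U : ModuleCat.{u} R} :
    IsNPresented 0 U ↔ ∃ (F : ModuleCat.{u} R) (φ : F →ₗ[R] U),
      Module.Free R F ∧ Module.Finite R F ∧ Function.Surjective φ := by
  constructor
  · rintro ⟨F, δ, ε, hF, hε, -, -⟩
    exact ⟨F 0, ε, (hF 0 le_rfl).1, (hF 0 le_rfl).2, hε⟩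
  · rintro ⟨F, φ, h1, h2, hφ⟩
    exact ⟨fun _ => F, fun _ => 0, φ, fun _ _ => ⟨h1, h2⟩, hφ, fun h => by omega,
      fun i h => by omega⟩

/-- Splitting off the first free module allows induction on `n` through syzygies. -/
theorem isNPresented_succ_iff {n : ℕ} {U : ModuleCat.{u} R} :
    IsNPresented (n + 1) U ↔ ∃ (F : ModuleCat.{u} R) (φ : F →ₗ[R] U),
      Module.Free R F ∧ Module.Finite R F ∧ Function.Surjective φ ∧
        IsNPresented n (ModuleCat.of R (LinearMap.ker φ)) := by
  constructor
  · rintro ⟨F, δ, ε, hF, hε, h0, hδ⟩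
    have h0 := h0 (by omega)
    refine ⟨F 0, ε, (hF 0 (by omega)).1, (hF 0 (by omega)).2, hε, fun i => F (i + 1),
      fun i => δ (i + 1), (δ 0).codRestrict _ fun x => h0.apply_apply_eq_zero x,
      fun i hi => hF _ (by omega), ?_, fun hn => ?_, fun i hi => hδ _ (by omega)⟩
    · rintro ⟨x, hx⟩
      obtain ⟨y, rfl⟩ := (h0 x).1 hx
      exact ⟨y, rfl⟩
    · intro x
      rw [← hδ 0 (by omega) x, ← Subtype.coe_inj]
      rfl
  · rintro ⟨F, φ, h1, h2, hφ, G, δ, ε, hG, hε, h0, hδ⟩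
    refine ⟨fun i => Nat.casesOn i F G, fun i => Nat.casesOn i
      ((LinearMap.ker φ).subtype ∘ₗ ε) δ, φ, ?_, hφ, fun _ => ?_, ?_⟩
    · rintro (_ | i) hi
      · exact ⟨h1, h2⟩
      · exact hG i (by omega)
    · intro x
      constructor
      · intro hx
        obtain ⟨y, hy⟩ := hε ⟨x, hx⟩
        exact ⟨y, congrArg Subtype.val hy⟩
      · rintro ⟨y, rfl⟩
        exact (ε y).2
    · rintro (_ | i) hi
      · intro x
        refine Iff.trans ?_ (h0 (by omega) x)
        exact Subtype.coe_inj (b := (0 : LinearMap.ker φ))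
      · exact hδ i (by omega)

/-- Adding `F` to both the module and its free cover leaves the first syzygy unchanged. -/
theorem IsNPresented.prod {n : ℕ} {U : ModuleCat.{u} R} (hU : IsNPresented n U)
    (F : Type u) [AddCommGroup F] [Module R F] [Module.Free R F] [Module.Finite R F] :
    IsNPresented n (ModuleCat.of R (U × F)) := by
  cases n with
  | zero =>
    obtain ⟨F₀, φ, h1, h2, hφ⟩ := isNPresented_zero_iff.1 hU
    exact isNPresented_zero_iff.2 ⟨ModuleCat.of R (F₀ × F), φ.prodMap LinearMap.id,
      inferInstanceAs (Module.Free R (F₀ × F)), inferInstanceAs (Module.Finite R (F₀ × F)),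
      hφ.prodMap Function.surjective_id⟩
  | succ n =>
    obtain ⟨F₀, φ, h1, h2, hφ, hK⟩ := isNPresented_succ_iff.1 hU
    refine isNPresented_succ_iff.2 ⟨ModuleCat.of R (F₀ × F), φ.prodMap LinearMap.id,
      inferInstanceAs (Module.Free R (F₀ × F)), inferInstanceAs (Module.Finite R (F₀ × F)),
      hφ.prodMap Function.surjective_id, hK.of_equiv ?_⟩
    refine LinearEquiv.ofBijective (LinearMap.codRestrict _
      (LinearMap.inl R F₀ F ∘ₗ (LinearMap.ker φ).subtype) fun x => ?_) ⟨fun x y hxy => ?_, ?_⟩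
    · exact Prod.ext x.2 rfl
    · exact Subtype.ext (congrArg (fun z => z.1.1) hxy)
    · rintro ⟨⟨x, y⟩, hxy⟩
      have hx : φ x = 0 := congrArg Prod.fst hxy
      have hy : y = 0 := congrArg Prod.snd hxy
      subst hy
      exact ⟨⟨x, hx⟩, rfl⟩

variable {S : Type u} [Ring S] {f : R →+* S} {c : R}

/-- A basis identifies `U` with a power of `R`, whose corner is the same power of `S`. -/
theorem CornerPair.free_finite (h : IsCorner f c) {U V : Type u} [AddCommGroup U] [Module R U]
    [AddCommGroup V] [Module S V] (P : CornerPair f c U V) [Module.Free R U] [Module.Finite R U] :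
    Module.Free S V ∧ Module.Finite S V := by
  let b := Module.Free.chooseBasis R U
  let Q := CornerPair.pi h (Module.Free.ChooseBasisIndex R U)
  let e := LinearEquiv.ofBijective (P.map h Q b.equivFun.toLinearMap)
    ⟨P.map_injective h Q b.equivFun.injective, P.map_surjective h Q b.equivFun.surjective⟩
  exact ⟨Module.Free.of_equiv e.symm, Module.Finite.equiv e.symm⟩

theorem IsNPresented.corner (h : IsCorner f c) {n : ℕ} {U : ModuleCat.{u} R}
    {V : ModuleCat.{u} S} (P : CornerPair f c U V) (hU : IsNPresented n U) :
    IsNPresented n V := by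
  obtain ⟨F, δ, ε, hF, hε, h0, hδ⟩ := hU
  refine ⟨fun i => ModuleCat.of S (h.Corner (F i)),
    fun i => (h.cornerPair (F (i + 1))).map h (h.cornerPair (F i)) (δ i),
    (h.cornerPair (F 0)).map h P ε, fun i hi => ?_,
    CornerPair.map_surjective _ _ _ hε, fun hn => CornerPair.map_exact _ _ _ _ (h0 hn),
    fun i hi => CornerPair.map_exact _ _ _ _ (hδ i hi)⟩
  have := (hF i hi).1
  have := (hF i hi).2
  exact (h.cornerPair (F i)).free_finite h

/-- Transport of a corner along an isomorphism. -/
def CornerPair.congr {U V V' : Type u} [AddCommGroup U] [Module R U] [AddCommGroup V] [Module S V]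
    [AddCommGroup V'] [Module S V'] (P : CornerPair f c U V) (e : V ≃ₗ[S] V') :
    CornerPair f c U V' where
  p := e.toLinearMap.toAddMonoidHom.comp P.p
  j := P.j.comp e.symm.toLinearMap.toAddMonoidHom
  p_smul a u := by simp [P.p_smul]
  j_smul a v := by simp [P.j_smul]
  p_j v := by simp [P.p_j]
  j_p u := by simp [P.j_p]

/-- The `R`-linear map `U → U'` that is induced by a map `V → V'` of corners and vanishes on
`(1 - c) U`. -/
def CornerPair.extend {U V U' V' : Type u} [AddCommGroup U] [Module R U] [AddCommGroup V]
    [Module S V] [AddCommGroup U'] [Module R U'] [AddCommGroup V'] [Module S V']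
    (P : CornerPair f c U V) (P' : CornerPair f c U' V') (φ : V →ₗ[S] V') : U →ₗ[R] U' where
  toFun u := P'.j (φ (P.p u))
  map_add' u u' := by simp
  map_smul' r u := by simp [P.p_smul, P'.j_smul]

/-- The `R`-linear map obtained from `ψ` by annihilating `c U`. -/
def IsCorner.complement (h : IsCorner f c) {U U' : Type u} [AddCommGroup U] [Module R U]
    [AddCommGroup U'] [Module R U'] (ψ : U →ₗ[R] U') : U →ₗ[R] U' where
  toFun u := ψ u - c • ψ u
  map_add' u u' := by simp only [map_add, smul_add]; abel
  map_smul' r u := by simp [smul_sub, h.unit_smul_comm]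

theorem CornerPair.p_complement (h : IsCorner f c) {U V U' : Type u} [AddCommGroup U] [Module R U]
    [AddCommGroup V] [Module S V] [AddCommGroup U'] [Module R U'] (P : CornerPair f c U V)
    (ψ : U' →ₗ[R] U) (u : U') : P.p (h.complement ψ u) = 0 := by
  change P.p (ψ u - c • ψ u) = 0
  rw [map_sub, P.p_unit_smul, sub_self]

theorem IsCorner.complement_apply_of_unit_smul_eq_zero (h : IsCorner f c) {U U' : Type u}
    [AddCommGroup U] [Module R U] [AddCommGroup U'] [Module R U'] (ψ : U →ₗ[R] U') {u : U}
    (hu : c • u = 0) : h.complement ψ u = ψ u := by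
  change ψ u - c • ψ u = ψ u
  rw [← map_smul, hu, map_zero, sub_zero]

theorem IsCorner.complement_unit_smul (h : IsCorner f c) {U U' : Type u}
    [AddCommGroup U] [Module R U] [AddCommGroup U'] [Module R U'] (ψ : U →ₗ[R] U') (u : U) :
    h.complement ψ (c • u) = 0 := by
  change ψ (c • u) - c • ψ (c • u) = 0
  rw [map_smul, h.unit_smul_smul, sub_self]

/-- In `u = c u + (1 - c) u`, the first summand is reached through `φ` and the second through `ψ`.
-/
theorem CornerPair.surjective_extend_coprod_complement (h : IsCorner f c)
    {U V W F W₀ : Type u} [AddCommGroup U] [Module R U] [AddCommGroup V] [Module S V]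
    [AddCommGroup W] [Module R W] [AddCommGroup F] [Module S F] [AddCommGroup W₀] [Module R W₀]
    (P : CornerPair f c U V) (P₀ : CornerPair f c W₀ F) {φ : F →ₗ[S] V}
    (hφ : Function.Surjective φ) {ψ : W →ₗ[R] U}
    (hψ : ∀ u, c • u = 0 → ∃ w, c • w = 0 ∧ ψ w = u) :
    Function.Surjective ((P₀.extend P φ).coprod (h.complement ψ)) := by
  intro u
  obtain ⟨a, ha⟩ := hφ (P.p u)
  obtain ⟨w, hw, hwu⟩ := hψ (u - c • u) (by rw [smul_sub, h.unit_smul_smul, sub_self])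
  refine ⟨(P₀.j a, w), ?_⟩
  rw [LinearMap.coprod_apply, h.complement_apply_of_unit_smul_eq_zero ψ hw, hwu]
  change P.j (φ (P₀.p (P₀.j a))) + _ = u
  rw [P₀.p_j, ha, P.j_p]
  abel

/-- An `R`-module `U` is `n`-presented if `c U` is `n`-presented over `S` and `(1 - c) U` is
isomorphic to `(1 - c) W` with `W` finitely generated and free. -/
theorem IsNPresented.of_corner (h : IsCorner f c) {n : ℕ} {U : ModuleCat.{u} R}
    {V : ModuleCat.{u} S} (P : CornerPair f c U V) (hV : IsNPresented n V)
    {W : Type u} [AddCommGroup W] [Module R W] [Module.Free R W] [Module.Finite R W]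
    (ψ : W →ₗ[R] U) (hinj : ∀ w, c • w = 0 → ψ w = 0 → w = 0)
    (hsurj : ∀ u, c • u = 0 → ∃ w, c • w = 0 ∧ ψ w = u) : IsNPresented n U := by
  induction n generalizing U V W with
  | zero =>
    obtain ⟨F, φ, h1, h2, hφ⟩ := isNPresented_zero_iff.1 hV
    let b := Module.Free.chooseBasis S F
    let P₀ := (CornerPair.pi h (Module.Free.ChooseBasisIndex S F)).congr b.equivFun.symm
    exact isNPresented_zero_iff.2 ⟨ModuleCat.of R ((Module.Free.ChooseBasisIndex S F → R) × W), _,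
      inferInstanceAs (Module.Free R ((Module.Free.ChooseBasisIndex S F → R) × W)),
      inferInstanceAs (Module.Finite R ((Module.Free.ChooseBasisIndex S F → R) × W)),
      P.surjective_extend_coprod_complement h P₀ hφ hsurj⟩
  | succ n ih =>
    obtain ⟨F, φ, h1, h2, hφ, hK⟩ := isNPresented_succ_iff.1 hV
    let b := Module.Free.chooseBasis S F
    let W₀ := Module.Free.ChooseBasisIndex S F → R
    let P₀ : CornerPair f c W₀ F :=
      (CornerPair.pi h (Module.Free.ChooseBasisIndex S F)).congr b.equivFun.symm
    let Φ := (P₀.extend P φ).coprod (h.complement ψ)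
    have hΦ : ∀ x y, Φ (x, y) = P.j (φ (P₀.p x)) + h.complement ψ y := fun _ _ => rfl
    refine isNPresented_succ_iff.2 ⟨ModuleCat.of R (W₀ × W), Φ,
      inferInstanceAs (Module.Free R (W₀ × W)), inferInstanceAs (Module.Finite R (W₀ × W)),
      P.surjective_extend_coprod_complement h P₀ hφ hsurj, ?_⟩
    let Q := h.cornerPair W
    obtain ⟨h3, h4⟩ := Q.free_finite h
    have hp : ∀ z : W₀ × W, Φ z = 0 → φ (P₀.p z.1) = 0 := by
      rintro ⟨x, y⟩ hz
      have := congrArg P.p hz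
      rwa [hΦ, map_add, P.p_j, P.p_complement h, add_zero, map_zero] at this
    -- Since `Φ` is induced by `φ` on `c W₀` and vanishes on `c W`, the corner of its kernel is `ker
    -- φ × c W`, with `c W` finitely generated free over `S`.
    let T : CornerPair f c (LinearMap.ker Φ) (LinearMap.ker φ × h.Corner W) :=
      { p := AddMonoidHom.mk' (fun z => (⟨P₀.p z.1.1, hp z.1 z.2⟩, Q.p z.1.2)) fun z z' =>
          Prod.ext (Subtype.ext (map_add P₀.p _ _)) (map_add Q.p _ _)
        j := AddMonoidHom.mk' (fun z => ⟨(P₀.j z.1, Q.j z.2), by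
            have hz : φ z.1 = 0 := z.1.2
            rw [LinearMap.mem_ker, hΦ, P₀.p_j, hz, map_zero, zero_add, ← Q.unit_smul_j,
              h.complement_unit_smul]⟩) fun z z' =>
          Subtype.ext (Prod.ext (map_add P₀.j _ _) (map_add Q.j _ _))
        p_smul := fun a z => Prod.ext (Subtype.ext (P₀.p_smul a _)) (Q.p_smul a _)
        j_smul := fun a z => Subtype.ext (Prod.ext (P₀.j_smul a _) (Q.j_smul a _))
        p_j := fun z => Prod.ext (Subtype.ext (P₀.p_j _)) (Q.p_j _)
        j_p := fun z => Subtype.ext (Prod.ext (P₀.j_p _) (Q.j_p _)) }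
    have hψ : ∀ x : W₀, (x - c • x, (0 : W)) ∈ LinearMap.ker Φ := fun x => by
      rw [LinearMap.mem_ker, hΦ, map_zero, add_zero, map_sub, P₀.p_unit_smul, sub_self, map_zero,
        map_zero]
    -- The other part of `ker Φ` is `(1 - c) W₀`: `Φ` vanishes there, while `ψ` is injective on `(1
    -- - c) W`. Thus `W₀` takes over the role of `W`.
    refine ih (U := ModuleCat.of R (LinearMap.ker Φ))
      (V := ModuleCat.of S (LinearMap.ker φ × h.Corner W)) T (hK.prod (h.Corner W)) (W := W₀)
      (((LinearMap.inl R W₀ W) ∘ₗ h.complement LinearMap.id).codRestrict _ hψ) ?_ ?_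
    · intro x hx hx0
      have : h.complement LinearMap.id x = 0 := congrArg (fun z => z.1.1) hx0
      rwa [h.complement_apply_of_unit_smul_eq_zero _ hx] at this
    · rintro ⟨⟨x, y⟩, hxy⟩ hc
      have hx : c • x = 0 := congrArg (fun z => z.1.1) hc
      have hy : c • y = 0 := congrArg (fun z => z.1.2) hc
      have hxy' : Φ (x, y) = 0 := hxy
      have hy0 : y = 0 := by
        refine hinj y hy ?_
        rw [hΦ, ← P₀.p_unit_smul, hx, map_zero, map_zero, map_zero, zero_add,
          h.complement_apply_of_unit_smul_eq_zero _ hy] at hxy'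
        exact hxy'
      refine ⟨x, hx, Subtype.ext (Prod.ext ?_ hy0.symm)⟩
      exact h.complement_apply_of_unit_smul_eq_zero LinearMap.id hx

theorem IsNPresented.restrictScalars (h : IsCorner f c) {n : ℕ} {V : ModuleCat.{u} S}
    (hV : IsNPresented n V) : IsNPresented n ((ModuleCat.restrictScalars f).obj V) := by
  -- Here `(1 - c) V_R = 0`, so the zero module serves as `W`.
  refine hV.of_corner h (h.restrictPair V) (W := PUnit.{u + 1}) 0
    (fun _ _ _ => Subsingleton.elim _ _) fun v hv => ⟨0, smul_zero c, ?_⟩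
  rw [h.restrict_unit_smul] at hv
  rw [hv, map_zero]

end Presented

/-! ### Acyclicity under exact functors and retracts -/

section Acyclic

variable {C D : Type*} [Category* C] [Category* D] [Abelian C] [Abelian D] {ι : Type*}
  {s : ComplexShape ι}

theorem acyclic_mapHomologicalComplex (F : C ⥤ D) [F.Additive] [F.PreservesHomology]
    {K : HomologicalComplex C s} (hK : K.Acyclic) :
    ((F.mapHomologicalComplex s).obj K).Acyclic := fun i =>
  ShortComplex.Exact.map (hK i) F

theorem isZero_of_retract {X Y : C} (i : X ⟶ Y) (r : Y ⟶ X) (hir : i ≫ r = 𝟙 X) (hY : IsZero Y) :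
    IsZero X := by
  rw [IsZero.iff_id_eq_zero, ← hir, hY.eq_of_tgt i 0, zero_comp]

theorem acyclic_mapHomologicalComplex_of_retract {F G : C ⥤ D} [F.PreservesZeroMorphisms]
    [G.PreservesZeroMorphisms] (α : F ⟶ G) (β : G ⟶ F) (hαβ : α ≫ β = 𝟙 F)
    {K : HomologicalComplex C s} (hK : ((G.mapHomologicalComplex s).obj K).Acyclic) :
    ((F.mapHomologicalComplex s).obj K).Acyclic := fun i => by
  have h1 := (HomologicalComplex.exactAt_iff_isZero_homology _ _).1 (hK i)
  refine (HomologicalComplex.exactAt_iff_isZero_homology _ _).2 (isZero_of_retract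
    (HomologicalComplex.homologyMap ((NatTrans.mapHomologicalComplex α s).app K) i)
    (HomologicalComplex.homologyMap ((NatTrans.mapHomologicalComplex β s).app K) i) ?_ h1)
  rw [← HomologicalComplex.homologyMap_comp, ← NatTrans.comp_app,
    ← NatTrans.mapHomologicalComplex_comp, hαβ, NatTrans.mapHomologicalComplex_id,
    NatTrans.id_app, HomologicalComplex.homologyMap_id]

end Acyclic

/-! ### Transfer of the (Gorenstein) flatness conditions -/

section Gorenstein

variable {R S : Type u} [Ring R] [Ring S] {f : R →+* S} {c : R} {n d : ℕ}

/-- `Tor^S_i(M c, V)` is a direct summand of `Tor^R_i(M, V_R)`: the inclusion. -/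
noncomputable def cornerTorInclusion (h : IsCorner f c) (V : ModuleCat.{u} S) (i : ℕ) :
    h.op.cornerFunctor ⋙ torFunctor i V ⟶ torFunctor i ((ModuleCat.restrictScalars f).obj V) :=
  Functor.whiskerLeft h.op.cornerFunctor (restrictTorIso h (h.restrictPair V) i).inv ≫
    Functor.whiskerRight h.op.inclusion (torFunctor i ((ModuleCat.restrictScalars f).obj V))

/-- `Tor^S_i(M c, V)` is a direct summand of `Tor^R_i(M, V_R)`: the projection. -/
noncomputable def cornerTorProjection (h : IsCorner f c) (V : ModuleCat.{u} S) (i : ℕ) :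
    torFunctor i ((ModuleCat.restrictScalars f).obj V) ⟶ h.op.cornerFunctor ⋙ torFunctor i V :=
  Functor.whiskerRight h.op.projection (torFunctor i ((ModuleCat.restrictScalars f).obj V)) ≫
    Functor.whiskerLeft h.op.cornerFunctor (restrictTorIso h (h.restrictPair V) i).hom

theorem cornerTorInclusion_projection (h : IsCorner f c) (V : ModuleCat.{u} S) (i : ℕ) :
    cornerTorInclusion h V i ≫ cornerTorProjection h V i = 𝟙 _ := by
  ext1
  ext1 M
  let T := torFunctor i ((ModuleCat.restrictScalars f).obj V)
  let e := (restrictTorIso h (h.restrictPair V) i).app (h.op.cornerFunctor.obj M)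
  have h1 : T.map (h.op.inclusion.app M) ≫ T.map (h.op.projection.app M) = 𝟙 _ := by
    rw [← T.map_comp, ← NatTrans.comp_app, h.op.inclusion_projection]
    exact T.map_id _
  change (e.inv ≫ T.map (h.op.inclusion.app M)) ≫ (T.map (h.op.projection.app M) ≫ e.hom) = 𝟙 _
  rw [Category.assoc, reassoc_of% h1]
  exact e.inv_hom_id

theorem IsNDFlat.restrictScalars (h : IsCorner f c) {N : ModuleCat.{u} Sᵐᵒᵖ}
    (hN : IsNDFlat n d N) :
    IsNDFlat n d ((ModuleCat.restrictScalars (RingHom.op f)).obj N) := fun U hU =>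
  (hN (ModuleCat.of S (h.Corner U)) (hU.corner h (h.cornerPair U))).of_iso
    ((restrictTorIso h (V := ModuleCat.of S (h.Corner U)) (h.cornerPair U) (d + 1)).app N)

/-- Each `Tor^S_{d+1}(M c, V)` is a retract of `Tor^R_{d+1}(M, V_R)`, and `V_R` is again a test
module. -/
theorem IsNDFlat.corner (h : IsCorner f c) {M : ModuleCat.{u} Rᵐᵒᵖ} (hM : IsNDFlat n d M) :
    IsNDFlat n d (h.op.cornerFunctor.obj M) := fun V hV =>
  isZero_of_retract ((cornerTorInclusion h V (d + 1)).app M)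
    ((cornerTorProjection h V (d + 1)).app M)
    (NatTrans.congr_app (cornerTorInclusion_projection h V (d + 1)) M)
    (hM _ (hV.restrictScalars h))

theorem IsGorensteinNDFlat.of_iso {G G' : ModuleCat.{u} Rᵐᵒᵖ} (e : G ≅ G')
    (hG : IsGorensteinNDFlat n d G) : IsGorensteinNDFlat n d G' := by
  obtain ⟨F, hF, hac, ⟨k⟩, hT⟩ := hG
  exact ⟨F, hF, hac, ⟨e.symm ≪≫ k⟩, hT⟩

/-- The restricted complex works: testing it against `U` amounts to testing the original against `c
U`. -/
theorem IsGorensteinNDFlat.restrictScalars (h : IsCorner f c) {G : ModuleCat.{u} Sᵐᵒᵖ}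
    (hG : IsGorensteinNDFlat n d G) :
    IsGorensteinNDFlat n d ((ModuleCat.restrictScalars (RingHom.op f)).obj G) := by
  obtain ⟨F, hF, hac, ⟨k⟩, hT⟩ := hG
  have := h.op.restrictScalars_preservesHomology
  let e : (ModuleCat.restrictScalars (RingHom.op f)).obj
        (ModuleCat.of Sᵐᵒᵖ (LinearMap.ker (F.d 0 1).hom)) ≃ₗ[Rᵐᵒᵖ]
      LinearMap.ker ((ModuleCat.restrictScalars (RingHom.op f)).map (F.d 0 1)).hom :=
    { toFun := fun x => ⟨x.1, x.2⟩
      invFun := fun x => ⟨x.1, x.2⟩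
      map_add' := fun _ _ => rfl
      map_smul' := fun _ _ => rfl }
  refine ⟨((ModuleCat.restrictScalars (RingHom.op f)).mapHomologicalComplex _).obj F,
    fun i => (hF i).restrictScalars h, acyclic_mapHomologicalComplex _ hac,
    ⟨(ModuleCat.restrictScalars (RingHom.op f)).mapIso k ≪≫ e.toModuleIso⟩, fun U hU hU' => ?_⟩
  let t := restrictTorIso h (V := ModuleCat.of S (h.Corner U)) (h.cornerPair U) d
  exact acyclic_mapHomologicalComplex_of_retract t.hom t.inv t.hom_inv_id
    (hT _ (hU.corner h (h.cornerPair U)) (hU'.corner h (h.cornerPair U)))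

theorem IsGorensteinNDFlat.corner (h : IsCorner f c) {G : ModuleCat.{u} Rᵐᵒᵖ}
    (hG : IsGorensteinNDFlat n d G) : IsGorensteinNDFlat n d (h.op.cornerFunctor.obj G) := by
  obtain ⟨F, hF, hac, ⟨k⟩, hT⟩ := hG
  let P := h.op.cornerPair (F.X 0)
  let P' := h.op.cornerPair (F.X 1)
  -- The kernel of the induced map is a corner of the kernel, so uniqueness of corners identifies it
  -- with the image of `G`.
  let Q : CornerPair (RingHom.op f) (MulOpposite.op c) (LinearMap.ker (F.d 0 1).hom)
      (LinearMap.ker (P.map h.op P' (F.d 0 1).hom)) :=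
    P.submodule _ _ (fun u hu => by
      rw [LinearMap.mem_ker] at hu ⊢
      rw [P.map_p, hu, map_zero]) fun v hv => by
      rw [LinearMap.mem_ker] at hv ⊢
      rw [← P.j_map h.op P', hv, map_zero]
  exact ⟨(h.op.cornerFunctor.mapHomologicalComplex _).obj F,
    fun i => (hF i).corner h, acyclic_mapHomologicalComplex _ hac,
    ⟨h.op.cornerFunctor.mapIso k ≪≫ ((h.op.cornerPair _).equiv h.op Q).toModuleIso⟩,
    fun V hV hV' => acyclic_mapHomologicalComplex_of_retract (cornerTorInclusion h V d)
      (cornerTorProjection h V d) (cornerTorInclusion_projection h V d)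
      (hT _ (hV.restrictScalars h) (hV'.restrictScalars h))⟩

/-- If `f : R → S` is surjective, then `G_R ⊗_R S ≅ G` for every right `S`-module `G`. -/
noncomputable def extendRightRestrictIso (hf : Function.Surjective f) (G : ModuleCat.{u} Sᵐᵒᵖ) :
    extendRight f ((ModuleCat.restrictScalars (RingHom.op f)).obj G) ≅ G :=
  letI : Module R S := Module.compHom S f
  haveI : SMulCommClass R Sᵐᵒᵖ S := ⟨fun r s x => by
    change f r * (x * s.unop) = (f r * x) * s.unop
    rw [mul_assoc]⟩
  let GR := (ModuleCat.restrictScalars (RingHom.op f)).obj G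
  let act : GR →+ S →+ G := AddMonoidHom.mk'
    (fun g => AddMonoidHom.mk' (fun s => (MulOpposite.op s • (show G from g) : G))
      fun s s' => by rw [MulOpposite.op_add, add_smul]) fun g g' => by
        ext s
        exact smul_add (MulOpposite.op s) (show G from g) (show G from g')
  let φ : Tensor R GR S →+ G := Tensor.lift act fun g r s => by
    change MulOpposite.op s • MulOpposite.op (f r) • (show G from g) =
      MulOpposite.op (f r * s) • (show G from g)
    rw [smul_smul, ← MulOpposite.op_mul]
  LinearEquiv.toModuleIso (X₁ := Tensor R GR S)
    { toFun := φ
      invFun := fun g => Tensor.tmul R (show GR from g) (1 : S)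
      map_add' := map_add φ
      map_smul' := fun s x => by
        refine DFunLike.congr_fun (Tensor.hom_ext
          (φ := φ.comp (Tensor.map LinearMap.id (rightMul R S s)))
          (ψ := (DistribSMul.toAddMonoidHom G s).comp φ) fun g t => ?_) x
        change MulOpposite.op (t * s.unop) • (show G from g) =
          s • MulOpposite.op t • (show G from g)
        rw [smul_smul, MulOpposite.op_mul, MulOpposite.op_unop]
      left_inv := fun x => by
        refine DFunLike.congr_fun (Tensor.hom_ext
          (φ := AddMonoidHom.comp ((Tensor.tmulHom R GR S).flip 1) φ)
          (ψ := AddMonoidHom.id _) fun g t => ?_) x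
        -- Surjectivity enters here: `g ⊗ f r = g r ⊗ 1`.
        obtain ⟨r, rfl⟩ := hf t
        refine (Tensor.smul_tmul g r (1 : S)).trans ?_
        change Tensor.tmul R g (f r * 1) = Tensor.tmul R g (f r)
        rw [mul_one]
      right_inv := fun g => one_smul _ (show G from g) }

end Gorenstein

end GorFlat

theorem theorem4p3 {R S : Type u} [Ring R] [Ring S] (n d : ℕ)
    (f : R →+* S) (hf : Function.Surjective f)
    (hleft : Module.Projective R ((ModuleCat.restrictScalars f).obj (ModuleCat.of S S)))
    (hright : Module.Projective Rᵐᵒᵖ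
      ((ModuleCat.restrictScalars (RingHom.op f)).obj (ModuleCat.of Sᵐᵒᵖ S)))
    (G : ModuleCat.{u} Sᵐᵒᵖ) :
    List.TFAE
      [GorFlat.IsGorensteinNDFlat n d ((ModuleCat.restrictScalars (RingHom.op f)).obj G),
       GorFlat.IsGorensteinNDFlat n d
        (GorFlat.extendRight f ((ModuleCat.restrictScalars (RingHom.op f)).obj G)),
       GorFlat.IsGorensteinNDFlat n d G] := by
  obtain ⟨c, h⟩ := GorFlat.exists_isCorner f hf hleft hright
  -- `G` is recovered as the corner of `G_R`.
  tfae_have 1 → 3 := fun hG => (hG.corner h).of_iso (h.op.restrictCornerIso.app G).symm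
  tfae_have 3 → 1 := fun hG => hG.restrictScalars h
  tfae_have 2 → 3 := fun hG => hG.of_iso (GorFlat.extendRightRestrictIso hf G)
  tfae_have 3 → 2 := fun hG => hG.of_iso (GorFlat.extendRightRestrictIso hf G).symm
  tfae_finish
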